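/- Let $H$ be a Hilbert space, not necessarily separable, over $\mathbb D=\mathbb R$, $\mathbb C$ or $\mathbb H$ (the quaternions). Scalars act on the right and the scalar product $\langle\cdot|\cdot\rangle$ is $\mathbb D$-linear in its right entry. Let $B(H)$ be the real algebra of bounded $\mathbb D$-linear operators on $H$, and $A^*$ the adjoint of $A$. An operator $A\in B(H)$ is positive, $A\ge 0$, if $\langle u|Au\rangle$ is real and nonnegative for all $u\in H$; $A\ge B$ means $A-B\ge 0$. The absolute value $|T|=\sqrt{T^*T}$ is the unique self-adjoint positive operator with $|T|\,|T|=T^*T$. Let $B_1(H)$ be the set of trace-class operators, i.e. of those $T\in B(H)$ with $\sum_{u\in N}\langle u|\,|T|u\rangle<+\infty$ for some Hilbert basis $N$ of $H$. For a Hilbert basis $N$ of $H$ put $tr_N(A)=\sum_{u\in N}\langle u|Au\rangle$, and let the real trace be $tr^{\mathbb R}(A)=\mathrm{Re}\,(tr_N(A))$. If $tr_N(A)$ does not depend on $N$, it is denoted by $tr(A)$. For $A\in B_1(H)$ the series $tr_N(A)$ converges absolutely for every Hilbert basis $N$, and $tr^{\mathbb R}(A)$ does not depend on $N$. Moreover: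 (a) $B_1(H)$ is a real vector space, closed under $A\mapsto A^*$, and $tr^{\mathbb R}:B_1(H)\to\mathbb R$ is $\mathbb R$-linear and satisfies $tr^{\mathbb R}(A^*)=tr^{\mathbb R}(A)$. (b) $tr^{\mathbb R}(A)\ge 0$ for every positive $A\in B_1(H)$. (c) $tr^{\mathbb R}(A)\ge tr^{\mathbb R}(B)$ for all $A,B\in B_1(H)$ with $A\ge B$. (d) If $A\in B_1(H)$ and $B\in B(H)$, then $AB,BA\in B_1(H)$ and $tr^{\mathbb R}(AB)=tr^{\mathbb R}(BA)$. (e) If $A=A^*\in B_1(H)$, then $tr(A)$ exists and $tr^{\mathbb R}(A)=tr(A)$. (f) Let $A=A^*\in B_1(H)$ and $B=B^*\in B(H)$. (i) If $\mathbb D=\mathbb R$ or $\mathbb C$, then $tr(AB)$ exists and $tr^{\mathbb R}(AB)=tr(AB)$. (ii) If $\mathbb D=\mathbb H$, then $tr^{\mathbb R}(AB)=tr_{N_A}(AB)$ for every Hilbert basis $N_A$ of $H$ that completes a Hilbert basis of $\mathrm{Ker}(A)^\perp$ made of eigenvectors of $A$. (g) If $A=A^*\in B_1(H)$ and $P\in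 B(H)$ is an orthogonal projector ($P=PP=P^*$), then $PA,PAP\in B_1(H)$, $tr(PAP)$ exists, and $tr^{\mathbb R}(PA)=tr^{\mathbb R}(PAP)=tr(PAP)$. -/

import Mathlib

open scoped Quaternion

/-! Traces of operators on a real, complex or quaternionic Hilbert space, with scalars acting on the
right and the scalar product linear in its right entry. -/

namespace RealTrace

/-- The three possible kinds of scalars of a Hilbert space. -/
inductive ScalarKind where
  | real
  | complex
  | quaternionic

/-- The scalars `𝔻` : one of `ℝ`, `ℂ` and `ℍ`. -/
def Scalar : ScalarKind → Type
  | .real => ℝ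
  | .complex => ℂ
  | .quaternionic => ℍ

noncomputable section

namespace Scalar

instance instNormedDivisionRing : ∀ k : ScalarKind, NormedDivisionRing (Scalar k)
  | .real => (inferInstance : NormedDivisionRing ℝ)
  | .complex => (inferInstance : NormedDivisionRing ℂ)
  | .quaternionic => (inferInstance : NormedDivisionRing ℍ)

/-- The conjugation `q ↦ star q` : trivial on `ℝ`, the usual conjugation on `ℂ` and on `ℍ`. -/
instance instStarRing : ∀ k : ScalarKind, StarRing (Scalar k)
  | .real => (inferInstance : StarRing ℝ)
  | .complex => (inferInstance : StarRing ℂ)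
  | .quaternionic => (inferInstance : StarRing ℍ)

/-- Real numbers are seen in `𝔻` through `algebraMap ℝ (Scalar k)`. -/
instance instNormedAlgebra : ∀ k : ScalarKind, NormedAlgebra ℝ (Scalar k)
  | .real => (inferInstance : NormedAlgebra ℝ ℝ)
  | .complex => (inferInstance : NormedAlgebra ℝ ℂ)
  | .quaternionic => (inferInstance : NormedAlgebra ℝ ℍ)

/-- The real part of a scalar. -/
def re : ∀ {k : ScalarKind}, Scalar k → ℝ
  | .real => fun q : ℝ => q
  | .complex => Complex.re
  | .quaternionic => fun q : ℍ => q.re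

variable {k : ScalarKind}

theorem re_add (p q : Scalar k) : re (p + q) = re p + re q := by
  cases k
  · rfl
  · exact Complex.add_re p q
  · exact QuaternionAlgebra.re_add (R := ℝ) p q

theorem re_smul (r : ℝ) (q : Scalar k) : re (r • q) = r * re q := by
  cases k
  · rfl
  · exact Complex.smul_re r q
  · exact QuaternionAlgebra.re_smul (R := ℝ) r q

theorem re_algebraMap (r : ℝ) : re (algebraMap ℝ (Scalar k) r) = r := by
  cases k <;> rfl

theorem re_star (q : Scalar k) : re (star q) = re q := by
  cases k
  · rfl
  · exact Complex.conj_re q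
  · exact Quaternion.re_star q

theorem re_mul_comm (p q : Scalar k) : re (p * q) = re (q * p) := by
  cases k
  · exact mul_comm (G := ℝ) p q
  · exact congrArg Complex.re (mul_comm (G := ℂ) p q)
  · have h := Quaternion.re_mul (R := ℝ) p q
    have h' := Quaternion.re_mul (R := ℝ) q p
    refine h.trans (Eq.trans ?_ h'.symm)
    ring

theorem re_self_mul_star (q : Scalar k) : re (q * star q) = ‖q‖ ^ 2 := by
  cases k
  · exact (sq_abs (α := ℝ) q).symm ▸ (sq (M := ℝ) q).symm
  · have h := Complex.mul_conj' q
    have h' := congrArg Complex.re h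
    refine h'.trans ?_
    rw [← Complex.ofReal_pow]
    rfl
  · have h := Quaternion.normSq_eq_norm_mul_self q
    refine Eq.trans ?_ (h.trans (sq _).symm)
    rfl

/-- A scalar `q` with `Re (q p) = 0` for all `p` vanishes. -/
theorem eq_zero_of_re_mul (q : Scalar k) (h : ∀ p : Scalar k, re (q * p) = 0) : q = 0 := by
  have h1 := h (star q)
  rw [re_self_mul_star] at h1
  exact norm_eq_zero.1 (pow_eq_zero_iff (two_ne_zero) |>.1 h1)

end Scalar

/-- A real, complex or quaternionic Hilbert space `H` (according to `k`); completeness is asked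
separately, through `CompleteSpace H`. Scalars act on the right: the vector `x q` is
`MulOpposite.op q • x`. The underlying real vector space structure of `H` is the restriction of the
scalars to `ℝ`. -/
class HilbertSpaceOver (k : ScalarKind) (H : Type*) [NormedAddCommGroup H] [NormedSpace ℝ H]
    extends Module (Scalar k)ᵐᵒᵖ H, IsScalarTower ℝ (Scalar k)ᵐᵒᵖ H where
  /-- The scalar product `⟨x|y⟩`. -/
  sprod : H → H → Scalar k
  sprod_add_right : ∀ x y z, sprod x (y + z) = sprod x y + sprod x z
  sprod_smul_right : ∀ (x y : H) (q : Scalar k),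
    sprod x (MulOpposite.op q • y) = sprod x y * q
  star_sprod : ∀ x y, star (sprod y x) = sprod x y
  sprod_self : ∀ x, sprod x x = algebraMap ℝ (Scalar k) (‖x‖ ^ 2)

/-- The bounded (right-)`𝔻`-linear operators on `H`. -/
abbrev BoundedOp (k : ScalarKind) (H : Type*) [NormedAddCommGroup H] [NormedSpace ℝ H]
    [HilbertSpaceOver k H] : Type _ :=
  H →L[(Scalar k)ᵐᵒᵖ] H

section Basic

variable (k : ScalarKind) {H : Type*} [NormedAddCommGroup H] [NormedSpace ℝ H]
  [HilbertSpaceOver k H]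

/-- The scalar product `⟨x|y⟩` with values in the scalars of kind `k`. -/
def sp (x y : H) : Scalar k := HilbertSpaceOver.sprod x y

theorem sp_add_right (x y z : H) : sp k x (y + z) = sp k x y + sp k x z :=
  HilbertSpaceOver.sprod_add_right x y z

theorem sp_smul_right (x y : H) (q : Scalar k) :
    sp k x (MulOpposite.op q • y) = sp k x y * q :=
  HilbertSpaceOver.sprod_smul_right x y q

theorem star_sp (x y : H) : star (sp k y x) = sp k x y :=
  HilbertSpaceOver.star_sprod x y

theorem sp_self (x : H) : sp k x x = algebraMap ℝ (Scalar k) (‖x‖ ^ 2) :=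
  HilbertSpaceOver.sprod_self x

theorem real_smul_eq (r : ℝ) (x : H) :
    r • x = MulOpposite.op (algebraMap ℝ (Scalar k) r) • x := by
  have h := smul_assoc r (1 : (Scalar k)ᵐᵒᵖ) x
  rw [one_smul] at h
  rw [← h, Algebra.algebraMap_eq_smul_one]
  rfl

theorem sp_real_smul_right (r : ℝ) (x y : H) : sp k x (r • y) = r • sp k x y := by
  rw [real_smul_eq k, sp_smul_right, ← Algebra.commutes,
    ← Algebra.smul_def]

theorem sp_add_left (x y z : H) : sp k (x + y) z = sp k x z + sp k y z := by
  rw [← star_sp, sp_add_right, star_add,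
    star_sp, star_sp]

theorem sp_smul_left (x y : H) (q : Scalar k) :
    sp k (MulOpposite.op q • x) y = star q * sp k x y := by
  rw [← star_sp, sp_smul_right, star_mul,
    star_sp]

/-- The real inner product `(x, y) ↦ Re ⟨x|y⟩` on `H`. -/
abbrev realInnerProductSpace : InnerProductSpace ℝ H where
  inner x y := Scalar.re (sp k x y)
  norm_sq_eq_re_inner x := by
    change _ = Scalar.re (sp k x x)
    rw [sp_self, Scalar.re_algebraMap]
  conj_inner_symm x y := by
    change Scalar.re (sp k y x) = Scalar.re (sp k x y)
    rw [← Scalar.re_star, star_sp]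
  add_left x y z := by rw [sp_add_left, Scalar.re_add]
  smul_left x y r := by
    change Scalar.re (sp k (r • x) y) = r * Scalar.re (sp k x y)
    rw [← Scalar.re_star, star_sp, sp_real_smul_right, Scalar.re_smul,
      ← Scalar.re_star (sp k y x), star_sp]

theorem ext_re_sp {x y : H} (h : ∀ z, Scalar.re (sp k x z) = Scalar.re (sp k y z)) : x = y := by
  let := realInnerProductSpace k (H := H)
  exact ext_inner_right ℝ h

theorem exists_adjoint [CompleteSpace H] (A : BoundedOp k H) :
    ∃ B : BoundedOp k H, ∀ x y, sp k (B x) y = sp k x (A y) := by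
  let := realInnerProductSpace k (H := H)
  let A' : H →L[ℝ] H := A.restrictScalars ℝ
  let B' : H →L[ℝ] H := ContinuousLinearMap.adjoint A'
  have hB : ∀ x y, Scalar.re (sp k (B' x) y) = Scalar.re (sp k x (A y)) := fun x y =>
    ContinuousLinearMap.adjoint_inner_left A' y x
  have hlin : ∀ (q : (Scalar k)ᵐᵒᵖ) (x : H), B' (q • x) = q • B' x := by
    intro q x
    obtain ⟨q, rfl⟩ := MulOpposite.op_surjective q
    refine ext_re_sp k fun z => ?_
    rw [hB, sp_smul_left, sp_smul_left, Scalar.re_mul_comm, Scalar.re_mul_comm (star q),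
      ← sp_smul_right, ← sp_smul_right, ← map_smul,
      ← hB]
  refine ⟨⟨⟨⟨B', map_add B'⟩, hlin⟩, B'.continuous⟩, fun x y => ?_⟩
  change sp k (B' x) y = sp k x (A y)
  refine sub_eq_zero.1 (Scalar.eq_zero_of_re_mul _ fun p => ?_)
  have h := hB x (MulOpposite.op p • y)
  rw [map_smul, sp_smul_right, sp_smul_right] at h
  rw [sub_mul, sub_eq_add_neg, Scalar.re_add, ← neg_one_smul ℝ, Scalar.re_smul, h]
  ring

end Basic

section Operators

variable {k : ScalarKind} {H : Type*} [NormedAddCommGroup H] [NormedSpace ℝ H]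
  [HilbertSpaceOver k H]

/-- The adjoint `A* = star A` of a bounded operator, i.e. the bounded operator with
`⟨A* x|y⟩ = ⟨x|A y⟩`. Mathlib's `IsSelfAdjoint A` then means `A* = A`, and `IsStarProjection P`
means that `P` is an orthogonal projector, `P P = P` and `P* = P`. -/
instance instStarBoundedOp [CompleteSpace H] : Star (BoundedOp k H) :=
  ⟨fun A => (exists_adjoint k A).choose⟩

theorem sp_star_left [CompleteSpace H] (A : BoundedOp k H) (x y : H) :
    sp k ((star A) x) y = sp k x (A y) :=
  (exists_adjoint k A).choose_spec x y

/-- `T` is positive: `⟨u|T u⟩` is a nonnegative real number for every `u`. -/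
def IsPositiveOp (T : BoundedOp k H) : Prop :=
  ∀ u : H, ∃ r : ℝ, 0 ≤ r ∧ sp k u (T u) = algebraMap ℝ (Scalar k) r

/-- `S` is the absolute value `|T| = √(T* T)`, i.e. the (unique) self-adjoint positive bounded
operator with `S S = T* T`. -/
def IsAbsOf [CompleteSpace H] (S T : BoundedOp k H) : Prop :=
  IsSelfAdjoint S ∧ IsPositiveOp S ∧ S * S = star T * T

variable (k) in
/-- The set `N` is orthonormal. -/
def IsOrthonormalSet (N : Set H) : Prop :=
  (∀ u ∈ N, sp k u u = 1) ∧ ∀ u ∈ N, ∀ v ∈ N, u ≠ v → sp k u v = 0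

variable (k) in
/-- `N` is a Hilbert basis of `H`: an orthonormal set with trivial orthogonal complement. -/
def IsHilbertBasis (N : Set H) : Prop :=
  IsOrthonormalSet k N ∧ ∀ x : H, (∀ u ∈ N, sp k u x = 0) → x = 0

theorem sp_eq_zero_symm {x y : H} (h : sp k x y = 0) : sp k y x = 0 := by
  rw [← star_sp, h, star_zero]

variable (k H) in
theorem exists_isHilbertBasis : ∃ N : Set H, IsHilbertBasis k N := by
  obtain ⟨N, hN⟩ := zorn_subset {N : Set H | IsOrthonormalSet k N} (by
    intro c hc hchain
    refine ⟨⋃₀ c, ⟨?_, ?_⟩, fun s hs => Set.subset_sUnion_of_mem hs⟩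
    · rintro u ⟨s, hs, hu⟩
      exact (hc hs).1 u hu
    · rintro u ⟨s, hs, hu⟩ v ⟨t, ht, hv⟩ huv
      rcases hchain.total hs ht with h | h
      · exact (hc ht).2 u (h hu) v hv huv
      · exact (hc hs).2 u hu v (h hv) huv)
  refine ⟨N, hN.prop, fun x hx => by_contra fun hx0 => ?_⟩
  have hnorm : ‖x‖ ≠ 0 := norm_ne_zero_iff.2 hx0
  let e : H := ‖x‖⁻¹ • x
  have he0 : ∀ u ∈ N, sp k u e = 0 := fun u hu => by
    change sp k u (‖x‖⁻¹ • x) = 0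
    rw [sp_real_smul_right, hx u hu, smul_zero]
  have he1 : sp k e e = 1 := by
    rw [sp_self, norm_smul, norm_inv, norm_norm, inv_mul_cancel₀ hnorm,
      one_pow, map_one]
  have hins : IsOrthonormalSet k (insert e N) := by
    refine ⟨?_, ?_⟩
    · rintro u (rfl | hu)
      · exact he1
      · exact hN.prop.1 u hu
    · rintro u (rfl | hu) v (rfl | hv) huv
      · exact absurd rfl huv
      · exact sp_eq_zero_symm (he0 v hv)
      · exact he0 u hu
      · exact hN.prop.2 u hu v hv huv
  have hmem : e ∈ N := hN.le_of_ge hins (Set.subset_insert e N) (Set.mem_insert e N)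
  have h10 : (1 : Scalar k) = 0 := he1.symm.trans (he0 e hmem)
  exact one_ne_zero h10

/-- `T` is of trace class: `∑_{u ∈ N} ⟨u| |T| u⟩ < +∞` for some Hilbert basis `N`
(the terms of this sum are nonnegative real numbers). -/
def IsTraceClass [CompleteSpace H] (T : BoundedOp k H) : Prop :=
  ∃ S : BoundedOp k H, IsAbsOf S T ∧
    ∃ N : Set H, IsHilbertBasis k N ∧ Summable fun u : N => sp k (u : H) (S u)

/-- The `N`-trace `tr_N(T) = ∑_{u ∈ N} ⟨u|T u⟩`, an element of `𝔻`. -/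
def basisTrace (N : Set H) (T : BoundedOp k H) : Scalar k :=
  ∑' u : N, sp k (u : H) (T u)

/-- The real trace `tr^ℝ(T) = Re tr_N(T)`, where `N` is some Hilbert basis of `H`. -/
def realTrace (T : BoundedOp k H) : ℝ :=
  Scalar.re (basisTrace (exists_isHilbertBasis k H).choose T)

/-- `tr(T)` exists and equals `t`: for every Hilbert basis `N`, the series defining `tr_N(T)`
converges, with sum `t`. -/
def HasTrace (T : BoundedOp k H) (t : Scalar k) : Prop :=
  ∀ N : Set H, IsHilbertBasis k N → HasSum (fun u : N => sp k (u : H) (T u)) t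

/-- `x` belongs to the orthogonal complement of the kernel of `A`. -/
def MemKerPerp (A : BoundedOp k H) (x : H) : Prop :=
  ∀ z : H, A z = 0 → sp k z x = 0

/-- `N` is a Hilbert basis of `H` which contains a Hilbert basis `M` of `Ker(A)^⊥` made of
eigenvectors of `A` (vectors `u ≠ 0` with `A u = u q` for some scalar `q`). -/
def IsEigenCompletion (A : BoundedOp k H) (N : Set H) : Prop :=
  IsHilbertBasis k N ∧ ∃ M ⊆ N,
    (∀ u ∈ M, MemKerPerp A u ∧ ∃ q : Scalar k, A u = MulOpposite.op q • u) ∧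
    ∀ x : H, MemKerPerp A x → (∀ u ∈ M, sp k u x = 0) → x = 0

end Operators

end

end RealTrace

open RealTrace

/-!
The proof compares the `𝔻`-Hilbert space `H` with the real Hilbert space underlying it, whose inner
product is `Re ⟨x|y⟩`. If `N` is a Hilbert basis of `H` over `𝔻` and `e` runs through an orthonormal
basis of `𝔻` over `ℝ`, the vectors `u e` form a real Hilbert basis (`exists_real_hilbertBasis`).
As `e e* = 1`, a `𝔻`-linear `A` satisfies `Re ⟨u e|A (u e)⟩ = Re ⟨u|A u⟩`. Hence the real trace of
`A` is, up to the factor `dim_ℝ 𝔻`, the trace of the underlying real operator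
(`IsRealTraceClass.exists_tsum_inner`), so that independence of the basis, linearity and cyclicity
come from the real case.

On a real Hilbert space, the trace-class operators are the products `Y* X` of two Hilbert–Schmidt
operators (`IsHilbertSchmidtProduct`), and the trace of `Y* X` is `∑ ⟨Y b, X b⟩`. Expanding in a
second Hilbert basis and exchanging the two sums turns this into `∑ ⟨X* c, Y* c⟩`
(`IsHilbertSchmidt.tsum_inner_star`); applied twice, this gives both the independence of the basis
and `tr (T V) = tr (V T)`. These operators are related to the definition through `|T|` by square
roots, which are built from the absolutely convergent Taylor series of `1 - √(1 - x)`, with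
coefficients given by the Catalan numbers, and by a polar decomposition. The square root lies in
the bicommutant, so `|T|` commutes with the scalars when `T` does: it is `𝔻`-linear
(`exists_isAbsOf`). The partial isometry of the polar decomposition only has to be real linear.

For self-adjoint `A`, every `⟨u|A u⟩` is real, and `tr_N A` is real as well. In a Hilbert basis
adapted to the spectral decomposition of `A`, the same holds for `⟨u|A B u⟩`. Over `ℝ` and `ℂ`,
multiplication by a scalar is itself a `𝔻`-linear operator, so the real trace determines all of
`tr_N (A B)`, and `tr_N (A B)` is real by cyclicity (`IsRealTraceClass.hasTrace_mul`).
-/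

namespace RealTrace

open scoped InnerProductSpace InnerProduct
open ContinuousLinearMap (adjoint)

/-! ### Square roots in a real Banach algebra -/

/-- The Taylor coefficients of `1 - √(1 - x) = ∑ sqrtCoeff n * x ^ (n + 1)`. -/
noncomputable def sqrtCoeff (n : ℕ) : ℝ := catalan n / 2 ^ (2 * n + 1)

theorem sqrtCoeff_nonneg (n : ℕ) : 0 ≤ sqrtCoeff n := by
  unfold sqrtCoeff
  positivity

theorem sqrtCoeff_zero : sqrtCoeff 0 = 1 / 2 := by
  simp [sqrtCoeff]

/-- The recursion of the Catalan numbers. -/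
theorem two_mul_sqrtCoeff_succ (n : ℕ) :
    2 * sqrtCoeff (n + 1) =
      ∑ ij ∈ Finset.HasAntidiagonal.antidiagonal n, sqrtCoeff ij.1 * sqrtCoeff ij.2 := by
  have h : ∀ ij ∈ Finset.HasAntidiagonal.antidiagonal n, sqrtCoeff ij.1 * sqrtCoeff ij.2 =
      ((catalan ij.1 * catalan ij.2 : ℕ) : ℝ) / 2 ^ (2 * n + 2) := by
    intro ij hij
    rw [Finset.HasAntidiagonal.mem_antidiagonal] at hij
    rw [sqrtCoeff, sqrtCoeff, div_mul_div_comm, ← pow_add, Nat.cast_mul, ← hij]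
    congr 2
    ring
  rw [Finset.sum_congr rfl h, ← Finset.sum_div, ← Nat.cast_sum, ← catalan_succ', sqrtCoeff]
  field_simp
  ring

theorem sum_range_sqrtCoeff_le_one (N : ℕ) : ∑ n ∈ Finset.range N, sqrtCoeff n ≤ 1 := by
  induction N with
  | zero => simp
  | succ N ih =>
    have h0 : 0 ≤ ∑ n ∈ Finset.range N, sqrtCoeff n :=
      Finset.sum_nonneg fun n _ => sqrtCoeff_nonneg n
    -- `s_{N+1} ≤ (1 + s_N²) / 2`, since each pair `(i, j)` with `i + j < N` has `i, j < N`
    have hle : ∑ n ∈ Finset.range N, 2 * sqrtCoeff (n + 1) ≤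
        (∑ n ∈ Finset.range N, sqrtCoeff n) * ∑ n ∈ Finset.range N, sqrtCoeff n := by
      simp_rw [two_mul_sqrtCoeff_succ]
      rw [Finset.sum_mul_sum, ← Finset.sum_product', ← Finset.sum_biUnion]
      · refine Finset.sum_le_sum_of_subset_of_nonneg ?_ fun _ _ _ =>
          mul_nonneg (sqrtCoeff_nonneg _) (sqrtCoeff_nonneg _)
        intro ij hij
        simp only [Finset.mem_biUnion, Finset.mem_range,
          Finset.HasAntidiagonal.mem_antidiagonal] at hij
        simp only [Finset.mem_product, Finset.mem_range]
        omega
      · intro m _ n _ hmn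
        refine Finset.disjoint_left.2 fun ij hm hn => hmn ?_
        rw [Finset.HasAntidiagonal.mem_antidiagonal] at hm hn
        exact hm.symm.trans hn
    rw [Finset.sum_range_succ', sqrtCoeff_zero]
    rw [← Finset.mul_sum] at hle
    nlinarith

theorem summable_sqrtCoeff : Summable sqrtCoeff :=
  summable_of_sum_range_le sqrtCoeff_nonneg sum_range_sqrtCoeff_le_one

theorem tsum_sqrtCoeff_le_one : ∑' n, sqrtCoeff n ≤ 1 :=
  Real.tsum_le_of_sum_range_le sqrtCoeff_nonneg sum_range_sqrtCoeff_le_one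

section Banach

variable {A : Type*} [NormedRing A] [NormedAlgebra ℝ A]

theorem norm_sqrtCoeff_smul_pow_le [NormOneClass A] {X : A} (hX : ‖X‖ ≤ 1) (n : ℕ) :
    ‖sqrtCoeff n • X ^ n‖ ≤ sqrtCoeff n := by
  rw [norm_smul, Real.norm_of_nonneg (sqrtCoeff_nonneg n)]
  exact mul_le_of_le_one_right (sqrtCoeff_nonneg n)
    ((norm_pow_le X n).trans (pow_le_one₀ (norm_nonneg X) hX))

theorem summable_norm_sqrtCoeff_smul_pow [NormOneClass A] {X : A} (hX : ‖X‖ ≤ 1) :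
    Summable fun n => ‖sqrtCoeff n • X ^ n‖ :=
  Summable.of_nonneg_of_le (fun _ => norm_nonneg _) (norm_sqrtCoeff_smul_pow_le hX)
    summable_sqrtCoeff

/-- The solution `G = (1 - √(1 - X)) / X` of `2 G = 1 + X G²`, for `‖X‖ ≤ 1`. -/
noncomputable def sqrtSeries (X : A) : A := ∑' n, sqrtCoeff n • X ^ n

theorem commute_sqrtSeries {X C : A} (hC : Commute C X) :
    Commute C (sqrtSeries X) :=
  Commute.tsum_right C fun n => (hC.pow_right n).smul_right _

theorem norm_sqrtSeries_le_one [NormOneClass A] {X : A} (hX : ‖X‖ ≤ 1) : ‖sqrtSeries X‖ ≤ 1 :=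
  (tsum_of_norm_bounded summable_sqrtCoeff.hasSum (norm_sqrtCoeff_smul_pow_le hX)).trans
    tsum_sqrtCoeff_le_one

theorem two_smul_sqrtSeries [NormOneClass A] [CompleteSpace A] {X : A} (hX : ‖X‖ ≤ 1) :
    (2 : ℝ) • sqrtSeries X = 1 + X * (sqrtSeries X * sqrtSeries X) := by
  have hs := summable_norm_sqrtCoeff_smul_pow hX
  have hmul : sqrtSeries X * sqrtSeries X = ∑' n, (2 * sqrtCoeff (n + 1)) • X ^ n := by
    rw [sqrtSeries, tsum_mul_tsum_eq_tsum_sum_antidiagonal_of_summable_norm hs hs]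
    refine tsum_congr fun n => ?_
    rw [two_mul_sqrtCoeff_succ, Finset.sum_smul]
    refine Finset.sum_congr rfl fun ij hij => ?_
    rw [Finset.HasAntidiagonal.mem_antidiagonal] at hij
    rw [smul_mul_smul_comm, ← pow_add, hij]
  have hs' : Summable fun n => (2 * sqrtCoeff (n + 1)) • X ^ n := by
    refine Summable.of_norm_bounded
      (((summable_nat_add_iff 1).2 summable_sqrtCoeff).mul_left 2) fun n => ?_
    rw [mul_smul, norm_smul, norm_smul, Real.norm_of_nonneg (sqrtCoeff_nonneg _), Real.norm_two]
    gcongr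
    exact mul_le_of_le_one_right (sqrtCoeff_nonneg _)
      ((norm_pow_le X n).trans (pow_le_one₀ (norm_nonneg X) hX))
  rw [hmul, ← hs'.tsum_mul_left, sqrtSeries, ← hs.of_norm.tsum_const_smul,
    (hs.of_norm.const_smul (2 : ℝ)).tsum_eq_zero_add]
  congr 1
  · rw [sqrtCoeff_zero, smul_smul]
    norm_num
  · refine tsum_congr fun n => ?_
    rw [smul_smul, mul_smul_comm, ← pow_succ']

end Banach

section RealHilbert

universe u v w
variable {E : Type u} [NormedAddCommGroup E] [InnerProductSpace ℝ E]

/-! ### Square roots and polar decomposition on a real Hilbert space -/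

theorem norm_one_sub_le_one {T : E →L[ℝ] E} (hT : T.IsPositive) (h1 : ‖T‖ ≤ 1) :
    ‖1 - T‖ ≤ 1 := by
  refine ContinuousLinearMap.opNorm_le_bound _ zero_le_one fun x => ?_
  rw [one_mul]
  have hsymm : ⟪x, T (T x)⟫_ℝ = ⟪T x, T x⟫_ℝ := (hT.inner_left_eq_inner_right x (T x)).symm
  -- positivity at `x - T x` gives `‖T x‖² ≤ ⟨x, T x⟩`
  have hpos := hT.inner_nonneg_right (x - T x)
  have hle : ⟪T x, T (T x)⟫_ℝ ≤ ‖T x‖ ^ 2 := by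
    refine (real_inner_le_norm _ _).trans ?_
    rw [sq]
    gcongr
    exact (T.le_opNorm _).trans (mul_le_of_le_one_left (norm_nonneg _) h1)
  have hpos' := hT.inner_nonneg_right x
  rw [map_sub, inner_sub_left, inner_sub_right, inner_sub_right, hsymm,
    real_inner_self_eq_norm_sq] at hpos
  have hexp := norm_sub_sq_real x (T x)
  change ‖x - T x‖ ≤ ‖x‖
  refine le_of_sq_le_sq ?_ (norm_nonneg x)
  linarith

variable [CompleteSpace E]

/-- A positive operator has a positive square root, which lies in the bicommutant. -/
theorem exists_isPositive_sqrt {T : E →L[ℝ] E} (hT : T.IsPositive) :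
    ∃ R : E →L[ℝ] E, R.IsPositive ∧ R * R = T ∧ ∀ C, Commute C T → Commute C R := by
  rcases subsingleton_or_nontrivial E with hE | hE
  · exact ⟨T, hT, ContinuousLinearMap.ext fun x => Subsingleton.elim _ _, fun _ h => h⟩
  -- rescaling by `c` brings `T` into the domain `‖T‖ ≤ 1` of the series; `c ≠ 0` even if `T = 0`
  set c : ℝ := ‖T‖ + 1 with hc
  have hc0 : 0 < c := by positivity
  set X : E →L[ℝ] E := 1 - c⁻¹ • T with hXdef
  have hX : ‖X‖ ≤ 1 := by
    refine norm_one_sub_le_one (hT.smul_of_nonneg (by positivity)) ?_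
    rw [norm_smul, norm_inv, Real.norm_of_nonneg hc0.le, inv_mul_le_iff₀ hc0]
    linarith
  set G := sqrtSeries X with hG
  have hXG : Commute X G := commute_sqrtSeries (Commute.refl X)
  have hXsa : IsSelfAdjoint X :=
    (IsSelfAdjoint.one _).sub (hT.smul_of_nonneg (by positivity)).isSelfAdjoint
  have hGsa : IsSelfAdjoint G := by
    rw [isSelfAdjoint_iff, hG, sqrtSeries, tsum_star]
    exact tsum_congr fun n => ((IsSelfAdjoint.all (sqrtCoeff n)).smul (hXsa.pow n)).star_eq
  have hYsa : IsSelfAdjoint (X * G) := (hXsa.commute_iff hGsa).1 hXG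
  have hY : ‖X * G‖ ≤ 1 :=
    (norm_mul_le X G).trans (mul_le_one₀ hX (norm_nonneg G) (norm_sqrtSeries_le_one hX))
  -- `Y = X G` solves `2 Y = X + Y²`, that is `(1 - Y)² = 1 - X`
  have hquad : (2 : ℝ) • (X * G) = X + X * G * (X * G) := by
    rw [← mul_smul_comm, two_smul_sqrtSeries hX, mul_add, mul_one, ← hG, mul_assoc X G,
      ← mul_assoc G X, ← hXG.eq, mul_assoc X G]
  refine ⟨Real.sqrt c • (1 - X * G), ?_, ?_, fun C hC => ?_⟩
  · refine ContinuousLinearMap.IsPositive.smul_of_nonneg ?_ (Real.sqrt_nonneg c)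
    refine (ContinuousLinearMap.isPositive_iff' _).2 ⟨(IsSelfAdjoint.one _).sub hYsa, fun x => ?_⟩
    change 0 ≤ ⟪x - (X * G) x, x⟫_ℝ
    rw [inner_sub_left, real_inner_self_eq_norm_sq, sub_nonneg]
    refine (real_inner_le_norm _ _).trans ?_
    rw [sq]
    gcongr
    exact ((X * G).le_opNorm x).trans (mul_le_of_le_one_left (norm_nonneg _) hY)
  · have h1 : (1 - X * G) * (1 - X * G) = 1 - (2 : ℝ) • (X * G) + X * G * (X * G) := by
      rw [two_smul]
      noncomm_ring
    rw [smul_mul_smul_comm, Real.mul_self_sqrt hc0.le, h1, hquad, hXdef,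
      show ∀ Z : E →L[ℝ] E, 1 - (1 - c⁻¹ • T + Z) + Z = c⁻¹ • T from fun Z => by abel,
      smul_smul, mul_inv_cancel₀ hc0.ne', one_smul]
  · have hCX : Commute C X := (Commute.one_right C).sub_right (hC.smul_right _)
    exact ((Commute.one_right C).sub_right
      (hCX.mul_right (commute_sqrtSeries hCX))).smul_right _

/-- If `‖T x‖ = ‖S x‖` for all `x`, then `T` factors through `S`. -/
theorem exists_eq_mul_of_norm_eq {S T : E →L[ℝ] E} (h : ∀ x, ‖T x‖ = ‖S x‖) :
    ∃ V : E →L[ℝ] E, T = V * S := by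
  -- `S x ↦ T x` is isometric on the range of `S`; it is extended to the closure by continuity and
  -- to `E` by the orthogonal projection
  let K : Submodule ℝ E := S.range.topologicalClosure
  have hK : CompleteSpace K := S.range.isClosed_topologicalClosure.completeSpace_coe
  let e : E →ₗ[ℝ] K := S.toLinearMap.codRestrict K fun x =>
    S.range.le_topologicalClosure ⟨x, rfl⟩
  have he : DenseRange e := by
    intro y
    rw [closure_subtype, ← Set.range_comp]
    exact y.2
  have hb : ∃ C, ∀ x, ‖T.toLinearMap x‖ ≤ C * ‖e x‖ := ⟨1, fun x => by
    rw [one_mul]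
    exact (h x).le⟩
  refine ⟨(T.toLinearMap.extendOfNorm e) ∘L K.orthogonalProjectionOnto, ?_⟩
  ext x
  change T x = T.toLinearMap.extendOfNorm e (K.orthogonalProjectionOnto (S x))
  have hx : K.orthogonalProjectionOnto (S x) = e x :=
    Submodule.orthogonalProjectionOnto_mem_subspace_eq_self (K := K) (e x)
  rw [hx, LinearMap.extendOfNorm_eq he hb]
  rfl

/-- The two factorizations in the polar decomposition `T = V |T|`, `|T| = W T`. -/
theorem exists_polar_factors {S T : E →L[ℝ] E} (hS : IsSelfAdjoint S)
    (h : S * S = star T * T) : (∃ V, T = V * S) ∧ ∃ W, S = W * T := by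
  have hn : ∀ x, ‖T x‖ = ‖S x‖ := fun x => by
    refine (sq_eq_sq₀ (norm_nonneg _) (norm_nonneg _)).1 ?_
    rw [← real_inner_self_eq_norm_sq, ← real_inner_self_eq_norm_sq,
      ← ContinuousLinearMap.adjoint_inner_left, ← ContinuousLinearMap.adjoint_inner_left S]
    have h' := congrArg (fun Z : E →L[ℝ] E => ⟪Z x, x⟫_ℝ) h
    nth_rewrite 1 [← hS.star_eq] at h'
    exact h'.symm
  exact ⟨exists_eq_mul_of_norm_eq hn, exists_eq_mul_of_norm_eq fun x => (hn x).symm⟩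

/-! ### Hilbert–Schmidt operators on a real Hilbert space -/

/-- `X` is a Hilbert–Schmidt operator: `∑ ‖X b‖²` converges for some Hilbert basis `b`. -/
def IsHilbertSchmidt (X : E →L[ℝ] E) : Prop :=
  ∃ (s : Set E) (b : HilbertBasis s ℝ E), Summable fun i => ‖X (b i)‖ ^ 2

section Bases

variable {ι : Type v} {κ : Type w} (b : HilbertBasis ι ℝ E) (c : HilbertBasis κ ℝ E)

omit [CompleteSpace E] in
theorem summable_sq_inner {X : E →L[ℝ] E} (h : Summable fun i => ‖X (b i)‖ ^ 2) :
    Summable fun p : ι × κ => ⟪c p.2, X (b p.1)⟫_ℝ ^ 2 := by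
  have hp : ∀ i, HasSum (fun j => ⟪c j, X (b i)⟫_ℝ ^ 2) (‖X (b i)‖ ^ 2) := fun i => by
    have := c.hasSum_inner_mul_inner (X (b i)) (X (b i))
    rw [real_inner_self_eq_norm_sq] at this
    refine this.congr_fun fun j => ?_
    rw [real_inner_comm, sq]
  refine (summable_prod_of_nonneg fun _ => sq_nonneg _).2 ⟨fun i => (hp i).summable, ?_⟩
  simpa only [(hp _).tsum_eq] using h

theorem summable_norm_sq_adjoint {X : E →L[ℝ] E} (h : Summable fun i => ‖X (b i)‖ ^ 2) :
    Summable fun j => ‖(star X) (c j)‖ ^ 2 := by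
  have hs := ((summable_sq_inner b c h).prod_symm).prod
  refine hs.congr fun j => ?_
  have := b.hasSum_inner_mul_inner ((star X) (c j)) ((star X) (c j))
  rw [real_inner_self_eq_norm_sq] at this
  rw [← this.tsum_eq]
  refine tsum_congr fun i => ?_
  have h1 : ⟪(star X) (c j), b i⟫_ℝ = ⟪c j, X (b i)⟫_ℝ :=
    ContinuousLinearMap.adjoint_inner_left X (b i) (c j)
  change ⟪c j, X (b i)⟫_ℝ ^ 2 = _
  rw [real_inner_comm _ (b i), h1, ← sq]

theorem isHilbertSchmidt_iff {X : E →L[ℝ] E} :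
    IsHilbertSchmidt X ↔ Summable fun i => ‖X (b i)‖ ^ 2 := by
  constructor
  · rintro ⟨s, c, h⟩
    have := summable_norm_sq_adjoint c b (summable_norm_sq_adjoint c c h)
    rwa [star_star] at this
  · intro h
    obtain ⟨s, c, -⟩ := exists_hilbertBasis ℝ E
    have := summable_norm_sq_adjoint b c (summable_norm_sq_adjoint b b h)
    rw [star_star] at this
    exact ⟨s, c, this⟩

end Bases

theorem IsHilbertSchmidt.star {X : E →L[ℝ] E} (h : IsHilbertSchmidt X) :
    IsHilbertSchmidt (star X) := by
  obtain ⟨s, b, hb⟩ := h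
  exact ⟨s, b, summable_norm_sq_adjoint b b hb⟩

omit [CompleteSpace E] in
theorem IsHilbertSchmidt.mul_left {X : E →L[ℝ] E} (h : IsHilbertSchmidt X) (V : E →L[ℝ] E) :
    IsHilbertSchmidt (V * X) := by
  obtain ⟨s, b, hb⟩ := h
  refine ⟨s, b, Summable.of_nonneg_of_le (fun _ => sq_nonneg _) (fun i => ?_)
    (hb.mul_left (‖V‖ ^ 2))⟩
  rw [← mul_pow]
  gcongr
  exact V.le_opNorm _

theorem IsHilbertSchmidt.mul_right {X : E →L[ℝ] E} (h : IsHilbertSchmidt X) (V : E →L[ℝ] E) :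
    IsHilbertSchmidt (X * V) := by
  have := (h.star.mul_left (Star.star V)).star
  rwa [star_mul, star_star, star_star] at this

section Bases

variable {ι : Type v} {κ : Type w} (b : HilbertBasis ι ℝ E) (c : HilbertBasis κ ℝ E)
  {X Y : E →L[ℝ] E}

theorem IsHilbertSchmidt.summable_inner (hX : IsHilbertSchmidt X) (hY : IsHilbertSchmidt Y) :
    Summable fun i => ⟪Y (b i), X (b i)⟫_ℝ := by
  rw [isHilbertSchmidt_iff b] at hX hY
  refine Summable.of_norm_bounded (hY.add hX) fun i => ?_
  refine (norm_inner_le_norm _ _).trans ?_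
  nlinarith [sq_nonneg (‖Y (b i)‖ - ‖X (b i)‖), sq_nonneg ‖Y (b i)‖, sq_nonneg ‖X (b i)‖]

/-- Both sides are `∑ ⟨Y b, c⟩ ⟨c, X b⟩`, summed over all pairs of basis vectors. -/
theorem IsHilbertSchmidt.tsum_inner_star (hX : IsHilbertSchmidt X) (hY : IsHilbertSchmidt Y) :
    ∑' i, ⟪Y (b i), X (b i)⟫_ℝ = ∑' j, ⟪(Star.star X) (c j), (Star.star Y) (c j)⟫_ℝ := by
  rw [isHilbertSchmidt_iff b] at hX hY
  have hs : Summable fun p : ι × κ => ⟪Y (b p.1), c p.2⟫_ℝ * ⟪c p.2, X (b p.1)⟫_ℝ := by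
    refine Summable.of_norm_bounded
      ((summable_sq_inner b c hY).add (summable_sq_inner b c hX)) fun p => ?_
    rw [real_inner_comm, Real.norm_eq_abs, abs_le]
    constructor <;>
      nlinarith [sq_nonneg (⟪c p.2, Y (b p.1)⟫_ℝ + ⟪c p.2, X (b p.1)⟫_ℝ),
        sq_nonneg (⟪c p.2, Y (b p.1)⟫_ℝ - ⟪c p.2, X (b p.1)⟫_ℝ),
        sq_nonneg ⟪c p.2, Y (b p.1)⟫_ℝ, sq_nonneg ⟪c p.2, X (b p.1)⟫_ℝ]
  have hl : ∀ i, ⟪Y (b i), X (b i)⟫_ℝ = ∑' j, ⟪Y (b i), c j⟫_ℝ * ⟪c j, X (b i)⟫_ℝ :=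
    fun i => (c.tsum_inner_mul_inner _ _).symm
  have hr : ∀ j, ⟪(Star.star X) (c j), (Star.star Y) (c j)⟫_ℝ =
      ∑' i, ⟪Y (b i), c j⟫_ℝ * ⟪c j, X (b i)⟫_ℝ := fun j => by
    rw [← b.tsum_inner_mul_inner]
    refine tsum_congr fun i => ?_
    rw [mul_comm]
    congr 1
    · exact ContinuousLinearMap.adjoint_inner_right Y (b i) (c j)
    · exact ContinuousLinearMap.adjoint_inner_left X (b i) (c j)
  simp_rw [hl, hr]
  exact (Summable.tsum_comm (f := fun i j => ⟪Y (b i), c j⟫_ℝ * ⟪c j, X (b i)⟫_ℝ) hs).symm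

end Bases

/-! ### Trace-class operators on a real Hilbert space -/

/-- `T` is a product of two Hilbert–Schmidt operators; these are the trace-class operators of the
real Hilbert space `E`. -/
def IsHilbertSchmidtProduct (T : E →L[ℝ] E) : Prop :=
  ∃ X Y : E →L[ℝ] E, IsHilbertSchmidt X ∧ IsHilbertSchmidt Y ∧ T = star Y * X

namespace IsHilbertSchmidtProduct

variable {T : E →L[ℝ] E}

theorem mul_left (h : IsHilbertSchmidtProduct T) (V : E →L[ℝ] E) :
    IsHilbertSchmidtProduct (V * T) := by
  obtain ⟨X, Y, hX, hY, rfl⟩ := h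
  refine ⟨X, Y * star V, hX, hY.mul_right _, ?_⟩
  rw [star_mul, star_star, mul_assoc]

theorem mul_right (h : IsHilbertSchmidtProduct T) (V : E →L[ℝ] E) :
    IsHilbertSchmidtProduct (T * V) := by
  obtain ⟨X, Y, hX, hY, rfl⟩ := h
  exact ⟨X * V, Y, hX.mul_right _, hY, mul_assoc _ _ _⟩

protected theorem star (h : IsHilbertSchmidtProduct T) : IsHilbertSchmidtProduct (star T) := by
  obtain ⟨X, Y, hX, hY, rfl⟩ := h
  refine ⟨Y, X, hY, hX, ?_⟩
  rw [star_mul, star_star]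

variable {ι : Type v} {κ : Type w} (b : HilbertBasis ι ℝ E) (c : HilbertBasis κ ℝ E)

theorem summable_inner (h : IsHilbertSchmidtProduct T) :
    Summable fun i => ⟪b i, T (b i)⟫_ℝ := by
  obtain ⟨X, Y, hX, hY, rfl⟩ := h
  refine (hX.summable_inner b hY).congr fun i => ?_
  exact (ContinuousLinearMap.adjoint_inner_right Y (b i) (X (b i))).symm

theorem tsum_inner_eq (h : IsHilbertSchmidtProduct T) :
    ∑' i, ⟪b i, T (b i)⟫_ℝ = ∑' j, ⟪c j, T (c j)⟫_ℝ := by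
  obtain ⟨X, Y, hX, hY, rfl⟩ := h
  have key : ∀ x, ⟪x, (Star.star Y * X) x⟫_ℝ = ⟪Y x, X x⟫_ℝ := fun x =>
    ContinuousLinearMap.adjoint_inner_right Y x (X x)
  simp_rw [key]
  rw [hX.tsum_inner_star b b hY, hY.star.tsum_inner_star b c hX.star, star_star, star_star]

theorem tsum_inner_mul_comm (h : IsHilbertSchmidtProduct T) (V : E →L[ℝ] E) :
    ∑' i, ⟪b i, (T * V) (b i)⟫_ℝ = ∑' i, ⟪b i, (V * T) (b i)⟫_ℝ := by
  obtain ⟨X, Y, hX, hY, rfl⟩ := h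
  have h1 : ∀ x, ⟪x, (Star.star Y * X * V) x⟫_ℝ = ⟪Y x, (X * V) x⟫_ℝ := fun x =>
    ContinuousLinearMap.adjoint_inner_right Y x (X (V x))
  have h2 : ∀ x, ⟪x, (V * (Star.star Y * X)) x⟫_ℝ = ⟪(Y * Star.star V) x, X x⟫_ℝ := fun x =>
    (ContinuousLinearMap.adjoint_inner_left V ((adjoint Y) (X x)) x).symm.trans
      (ContinuousLinearMap.adjoint_inner_right Y (adjoint V x) (X x))
  have h3 : ∀ x, ⟪(Star.star (X * V)) x, (Star.star Y) x⟫_ℝ =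
      ⟪(Star.star X) x, (Star.star (Y * Star.star V)) x⟫_ℝ := fun x => by
    rw [star_mul, star_mul, star_star]
    exact ContinuousLinearMap.adjoint_inner_left V _ _
  simp_rw [h1, h2]
  rw [(hX.mul_right V).tsum_inner_star b b hY, hX.tsum_inner_star b b (hY.mul_right _)]
  exact tsum_congr fun i => h3 (b i)

end IsHilbertSchmidtProduct

/-- A positive operator with finite trace is a product of two Hilbert–Schmidt operators. -/
theorem isHilbertSchmidtProduct_of_isPositive {ι : Type v} (b : HilbertBasis ι ℝ E)
    {S : E →L[ℝ] E} (hS : S.IsPositive) (h : Summable fun i => ⟪b i, S (b i)⟫_ℝ) :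
    IsHilbertSchmidtProduct S := by
  obtain ⟨R, hR, hRS, -⟩ := exists_isPositive_sqrt hS
  have hRhs : IsHilbertSchmidt R := by
    refine (isHilbertSchmidt_iff b).2 (h.congr fun i => ?_)
    rw [← hRS, ← real_inner_self_eq_norm_sq]
    exact (hR.inner_left_eq_inner_right (b i) (R (b i))).symm
  exact ⟨R, R, hRhs, hRhs, by rw [hR.isSelfAdjoint.star_eq, hRS]⟩

/-- If `∑ ⟨b, V T b⟩` converges for every bounded `V`, then so does `∑ ⟨b, |T| b⟩`. -/
theorem isHilbertSchmidtProduct_of_summable {ι : Type v} (b : HilbertBasis ι ℝ E) {T : E →L[ℝ] E}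
    (h : ∀ V : E →L[ℝ] E, Summable fun i => ⟪b i, (V * T) (b i)⟫_ℝ) :
    IsHilbertSchmidtProduct T := by
  obtain ⟨S, hS, hST, -⟩ :=
    exists_isPositive_sqrt (ContinuousLinearMap.isPositive_adjoint_comp_self T)
  obtain ⟨⟨V, hV⟩, W, hW⟩ := exists_polar_factors hS.isSelfAdjoint hST
  rw [hV]
  refine (isHilbertSchmidtProduct_of_isPositive b hS ?_).mul_left V
  rw [hW]
  exact h W

namespace IsHilbertSchmidtProduct

variable {T T' : E →L[ℝ] E}

theorem add (h : IsHilbertSchmidtProduct T) (h' : IsHilbertSchmidtProduct T') :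
    IsHilbertSchmidtProduct (T + T') := by
  obtain ⟨s, b, -⟩ := exists_hilbertBasis ℝ E
  refine isHilbertSchmidtProduct_of_summable b fun V => ?_
  refine (((h.mul_left V).summable_inner b).add ((h'.mul_left V).summable_inner b)).congr
    fun i => ?_
  rw [mul_add, ← inner_add_right]
  rfl

theorem smul (h : IsHilbertSchmidtProduct T) (r : ℝ) : IsHilbertSchmidtProduct (r • T) := by
  simpa using h.mul_left (r • 1)

end IsHilbertSchmidtProduct

end RealHilbert

/-! ### Scalars -/

namespace Scalar

variable {k : ScalarKind}

instance instFiniteDimensional : FiniteDimensional ℝ (Scalar k) :=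
  match k with
  | .real => (inferInstance : FiniteDimensional ℝ ℝ)
  | .complex => (inferInstance : FiniteDimensional ℝ ℂ)
  | .quaternionic => (inferInstance : FiniteDimensional ℝ ℍ)

/-- The real inner product `(p, q) ↦ Re (star p * q)` on the scalars. -/
noncomputable abbrev innerProductSpace : InnerProductSpace ℝ (Scalar k) where
  inner p q := re (star p * q)
  norm_sq_eq_re_inner q := by
    change _ = re (star q * q)
    rw [re_mul_comm, re_self_mul_star]
  conj_inner_symm p q := by
    change re (star q * p) = re (star p * q)
    rw [← re_star, star_mul, star_star]
  add_left p q r := by rw [star_add, add_mul, re_add]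
  smul_left p q r := by
    change re (star (r • p) * q) = r * re (star p * q)
    rw [← re_star, star_mul, star_star, mul_smul_comm, re_smul, ← re_star (star p * q), star_mul,
      star_star]

attribute [local instance] innerProductSpace

theorem eq_algebraMap_re {q : Scalar k} (h : star q = q) : q = algebraMap ℝ (Scalar k) (re q) := by
  cases k
  · rfl
  · exact (Complex.conj_eq_iff_re.1 h).symm
  · exact Quaternion.star_eq_self.1 h

theorem star_algebraMap (r : ℝ) : star (algebraMap ℝ (Scalar k) r) = algebraMap ℝ (Scalar k) r := by
  cases k
  · rfl
  · exact Complex.conj_ofReal r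
  · exact Quaternion.star_coe r

theorem mul_comm_of_ne (hk : k ≠ .quaternionic) (p q : Scalar k) : p * q = q * p := by
  cases k
  · exact mul_comm (G := ℝ) p q
  · exact mul_comm (G := ℂ) p q
  · exact absurd rfl hk

theorem self_mul_star (q : Scalar k) : q * star q = algebraMap ℝ (Scalar k) (‖q‖ ^ 2) := by
  rw [← re_self_mul_star]
  exact eq_algebraMap_re (by rw [star_mul, star_star])

theorem re_star_mul_algebraMap_mul (q : Scalar k) (r : ℝ) :
    re (star q * algebraMap ℝ (Scalar k) r * q) = ‖q‖ ^ 2 * r := by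
  rw [re_mul_comm, ← mul_assoc, self_mul_star, ← map_mul, re_algebraMap]

theorem eq_zero_of_re_mul_star {q : Scalar k} (h : re (q * star q) = 0) : q = 0 := by
  rwa [re_self_mul_star, sq_eq_zero_iff, norm_eq_zero] at h

/-- The real part, as a continuous linear form. -/
noncomputable def reCLM : Scalar k →L[ℝ] ℝ :=
  LinearMap.toContinuousLinearMap
    { toFun := re, map_add' := re_add, map_smul' := re_smul }

theorem reCLM_apply (q : Scalar k) : reCLM q = re q := rfl

/-- An orthonormal basis of the scalars over `ℝ`. -/
noncomputable def onb : OrthonormalBasis (Fin (Module.finrank ℝ (Scalar k))) ℝ (Scalar k) :=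
  stdOrthonormalBasis ℝ (Scalar k)

end Scalar

/-! ### The real Hilbert space underlying `H` -/

section Transfer

variable {k : ScalarKind} {H : Type*} [NormedAddCommGroup H] [NormedSpace ℝ H]
  [HilbertSpaceOver k H]

attribute [local instance] Scalar.innerProductSpace

theorem norm_op_smul (q : Scalar k) (x : H) : ‖MulOpposite.op q • x‖ = ‖q‖ * ‖x‖ := by
  refine (sq_eq_sq₀ (norm_nonneg _) (by positivity)).1 ?_
  rw [← Scalar.re_algebraMap (k := k) (‖MulOpposite.op q • x‖ ^ 2), ← sp_self, sp_smul_left,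
    sp_smul_right, sp_self, ← mul_assoc, Scalar.re_star_mul_algebraMap_mul, mul_pow]

/-- The real linear operator `x ↦ x q`. -/
noncomputable def scalarOp (q : Scalar k) : H →L[ℝ] H :=
  LinearMap.mkContinuous
    { toFun := fun x => MulOpposite.op q • x
      map_add' := smul_add _
      map_smul' := fun r x => (smul_comm r (MulOpposite.op q) x).symm }
    ‖q‖ fun x => (norm_op_smul q x).le

/-- A bounded `𝔻`-linear operator, seen as a real linear one. -/
noncomputable abbrev realOp (A : BoundedOp k H) : H →L[ℝ] H := A.restrictScalars ℝ

theorem realOp_injective : Function.Injective (realOp : BoundedOp k H → H →L[ℝ] H) :=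
  fun _ _ h => ContinuousLinearMap.ext fun x => congrArg (fun C : H →L[ℝ] H => C x) h

theorem realOp_mul (A B : BoundedOp k H) : realOp (A * B) = realOp A * realOp B := rfl

theorem commute_scalarOp_realOp (q : Scalar k) (A : BoundedOp k H) :
    Commute (scalarOp q) (realOp A) :=
  ContinuousLinearMap.ext fun x => (A.map_smul (MulOpposite.op q) x).symm

/-- A real linear operator that commutes with the scalars is `𝔻`-linear. -/
theorem exists_realOp_eq {C : H →L[ℝ] H} (hC : ∀ q : Scalar k, Commute (scalarOp q) C) :
    ∃ A : BoundedOp k H, realOp A = C :=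
  ⟨⟨⟨⟨C, map_add C⟩, fun q x =>
    (congrArg (fun Z : H →L[ℝ] H => Z x) (hC q.unop).eq).symm⟩, C.continuous⟩, rfl⟩

section Adjoint

variable [CompleteSpace H]

theorem star_eq_of_sp {A B : BoundedOp k H} (h : ∀ x y, sp k (B x) y = sp k x (A y)) :
    star A = B := by
  ext x
  refine ext_re_sp k fun z => ?_
  rw [sp_star_left, h]

theorem sp_star_right (A : BoundedOp k H) (x y : H) : sp k x ((star A) y) = sp k (A x) y := by
  rw [← star_sp, sp_star_left, star_sp]

theorem star_mul_op (A B : BoundedOp k H) : star (A * B) = star B * star A :=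
  star_eq_of_sp fun x y => by
    change sp k ((star B) ((star A) x)) y = sp k x (A (B y))
    rw [sp_star_left, sp_star_left]

theorem realOp_star (A : BoundedOp k H) :
    letI := realInnerProductSpace k (H := H)
    realOp (star A) = star (realOp A) := by
  let := realInnerProductSpace k (H := H)
  refine (ContinuousLinearMap.eq_adjoint_iff _ _).2 fun x y => ?_
  exact congrArg Scalar.re (sp_star_left A x y)

theorem star_sp_self {A : BoundedOp k H} (hA : IsSelfAdjoint A) (u : H) :
    star (sp k u (A u)) = sp k u (A u) := by
  rw [star_sp, ← sp_star_right, hA.star_eq]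

/-- `⟨u|A u⟩` is real for self-adjoint `A`. -/
theorem sp_self_eq_algebraMap {A : BoundedOp k H} (hA : IsSelfAdjoint A) (u : H) :
    sp k u (A u) = algebraMap ℝ (Scalar k) (Scalar.re (sp k u (A u))) :=
  Scalar.eq_algebraMap_re (star_sp_self hA u)

theorem isPositive_realOp {S : BoundedOp k H} (hsa : IsSelfAdjoint S) (hS : IsPositiveOp S) :
    letI := realInnerProductSpace k (H := H)
    (realOp S).IsPositive := by
  let := realInnerProductSpace k (H := H)
  refine (ContinuousLinearMap.isPositive_iff' _).2 ⟨?_, fun x => ?_⟩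
  · rw [isSelfAdjoint_iff, ← realOp_star, hsa.star_eq]
  · obtain ⟨r, hr, h⟩ := hS x
    rw [real_inner_comm]
    change 0 ≤ Scalar.re (sp k x (S x))
    rwa [h, Scalar.re_algebraMap]

/-- Every bounded operator has an absolute value. -/
theorem exists_isAbsOf (T : BoundedOp k H) : ∃ S : BoundedOp k H, IsAbsOf S T := by
  let := realInnerProductSpace k (H := H)
  have hpos : (realOp (star T * T)).IsPositive := by
    rw [realOp_mul, realOp_star]
    exact ContinuousLinearMap.isPositive_adjoint_comp_self (realOp T)
  obtain ⟨R, hR, hRT, hcomm⟩ := exists_isPositive_sqrt hpos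
  obtain ⟨S, rfl⟩ := exists_realOp_eq fun q => hcomm _ (commute_scalarOp_realOp q (star T * T))
  have hsa : IsSelfAdjoint S := realOp_injective ((realOp_star S).trans hR.isSelfAdjoint.star_eq)
  refine ⟨S, hsa, fun u => ⟨_, hR.inner_nonneg_right u, sp_self_eq_algebraMap hsa u⟩, ?_⟩
  exact realOp_injective hRT

/-- The real Hilbert basis `{u e}` of `H`, where `u` runs through a Hilbert basis over `𝔻` and `e`
through an orthonormal basis of `𝔻` over `ℝ`. -/
theorem exists_real_hilbertBasis {N : Set H} (hN : IsHilbertBasis k N) :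
    letI := realInnerProductSpace k (H := H)
    ∃ b : HilbertBasis (N × Fin (Module.finrank ℝ (Scalar k))) ℝ H,
      ∀ p, b p = MulOpposite.op (Scalar.onb p.2 : Scalar k) • (p.1 : H) := by
  let := realInnerProductSpace k (H := H)
  classical
  let v : N × Fin (Module.finrank ℝ (Scalar k)) → H := fun p =>
    MulOpposite.op (Scalar.onb p.2 : Scalar k) • (p.1 : H)
  have hv : Orthonormal ℝ v := by
    rw [orthonormal_iff_ite]
    rintro ⟨u, i⟩ ⟨w, j⟩
    change Scalar.re (sp k (MulOpposite.op (Scalar.onb i : Scalar k) • (u : H))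
      (MulOpposite.op (Scalar.onb j : Scalar k) • (w : H))) = _
    rw [sp_smul_left, sp_smul_right]
    by_cases huw : u = w
    · subst huw
      rw [hN.1.1 u u.2, one_mul]
      refine (orthonormal_iff_ite.1 (Scalar.onb (k := k)).orthonormal i j).trans ?_
      simp
    · rw [hN.1.2 u u.2 w w.2 fun h => huw (Subtype.ext h), zero_mul, mul_zero, if_neg]
      · exact (map_zero (Scalar.reCLM (k := k)))
      · exact fun h => huw (congrArg Prod.fst h)
  refine ⟨HilbertBasis.mkOfOrthogonalEqBot hv ?_, fun p => by
    rw [HilbertBasis.coe_mkOfOrthogonalEqBot]⟩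
  rw [Submodule.eq_bot_iff]
  intro x hx
  refine hN.2 x fun u hu => ?_
  refine InnerProductSpace.ext_inner_left_basis (𝕜 := ℝ) (Scalar.onb (k := k)).toBasis fun j => ?_
  rw [inner_zero_right, OrthonormalBasis.coe_toBasis]
  change Scalar.re (star (Scalar.onb j : Scalar k) * sp k u x) = 0
  rw [← sp_smul_left]
  exact Submodule.mem_orthogonal _ x |>.1 hx (v (⟨u, hu⟩, j)) (Submodule.subset_span ⟨_, rfl⟩)

end Adjoint
end Transfer

section Trace

variable {k : ScalarKind} {H : Type*} [NormedAddCommGroup H] [NormedSpace ℝ H]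
  [HilbertSpaceOver k H]

attribute [local instance] Scalar.innerProductSpace

/-! ### The trace over a Hilbert basis and the trace of the underlying real operator -/

theorem onb_mul_star (j : Fin (Module.finrank ℝ (Scalar k))) :
    (Scalar.onb j : Scalar k) * star (Scalar.onb j : Scalar k) = 1 := by
  rw [Scalar.self_mul_star, (Scalar.onb (k := k)).orthonormal.1 j, one_pow, map_one]

theorem re_sp_onb_smul (A : BoundedOp k H) (j : Fin (Module.finrank ℝ (Scalar k))) (u : H) :
    Scalar.re (sp k (MulOpposite.op (Scalar.onb j : Scalar k) • u)
      (A (MulOpposite.op (Scalar.onb j : Scalar k) • u))) = Scalar.re (sp k u (A u)) := by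
  rw [map_smul, sp_smul_left, sp_smul_right, Scalar.re_mul_comm, mul_assoc, onb_mul_star, mul_one]

theorem norm_le_sum_abs_re (q : Scalar k) :
    ‖q‖ ≤ ∑ j, |Scalar.re (star (Scalar.onb j : Scalar k) * q)| := by
  conv_lhs => rw [← (Scalar.onb (k := k)).sum_repr' q]
  refine (norm_sum_le _ _).trans (Finset.sum_le_sum fun j _ => ?_)
  rw [norm_smul, (Scalar.onb (k := k)).orthonormal.1 j, mul_one]
  rfl

instance instNonemptyFin : Nonempty (Fin (Module.finrank ℝ (Scalar k))) :=
  ⟨⟨0, Module.finrank_pos⟩⟩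

theorem hasSum_algebraMap {ι : Type*} {f : ι → Scalar k} (hf : Summable f)
    (hstar : ∀ i, star (f i) = f i) :
    HasSum f (algebraMap ℝ (Scalar k) (Scalar.re (∑' i, f i))) := by
  have h1 : HasSum (fun i => Scalar.re (f i)) (Scalar.re (∑' i, f i)) :=
    hf.hasSum.mapL Scalar.reCLM
  have h2 := h1.mapL (algebraMapCLM ℝ (Scalar k))
  refine h2.congr_fun fun i => ?_
  exact Scalar.eq_algebraMap_re (hstar i)

variable [CompleteSpace H]

/-- The real operator underlying `A` is a product of two Hilbert–Schmidt operators. -/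
def IsRealTraceClass (A : BoundedOp k H) : Prop :=
  letI := realInnerProductSpace k (H := H)
  IsHilbertSchmidtProduct (realOp A)

theorem isRealTraceClass_zero : IsRealTraceClass (0 : BoundedOp k H) := by
  let := realInnerProductSpace k (H := H)
  obtain ⟨s, b, -⟩ := exists_hilbertBasis ℝ H
  exact isHilbertSchmidtProduct_of_isPositive b ContinuousLinearMap.isPositive_zero
    (by simp)

/-- `A = V S` with `S = |A|`, and the trace of `S` over the real basis is `dim_ℝ 𝔻` times the
assumed convergent sum. -/
theorem IsTraceClass.isRealTraceClass {A : BoundedOp k H} (hA : IsTraceClass A) :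
    IsRealTraceClass A := by
  let := realInnerProductSpace k (H := H)
  obtain ⟨S, ⟨hsa, hpos, hSA⟩, N, hN, hsum⟩ := hA
  obtain ⟨b, hb⟩ := exists_real_hilbertBasis hN
  have hS := isPositive_realOp hsa hpos
  have hSA' : realOp S * realOp S = star (realOp A) * realOp A := by
    rw [← realOp_star, ← realOp_mul, ← realOp_mul, hSA]
  obtain ⟨⟨V, hV⟩, -⟩ := exists_polar_factors hS.isSelfAdjoint hSA'
  change IsHilbertSchmidtProduct (realOp A)
  rw [hV]
  refine (isHilbertSchmidtProduct_of_isPositive b hS ?_).mul_left V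
  have hre : Summable fun u : N => Scalar.re (sp k (u : H) (S u)) :=
    (hsum.hasSum.mapL Scalar.reCLM).summable
  have hterm : ∀ p, ⟪b p, realOp S (b p)⟫_ℝ = Scalar.re (sp k (p.1 : H) (S p.1)) := fun p => by
    rw [hb p]
    exact re_sp_onb_smul S p.2 p.1
  simp_rw [hterm]
  refine (summable_prod_of_nonneg fun p => ?_).2 ⟨fun _ => Summable.of_finite, ?_⟩
  · rw [← hterm p]
    exact hS.inner_nonneg_right _
  · simp only [tsum_const]
    exact hre.const_smul _

namespace IsRealTraceClass

variable {A B : BoundedOp k H} {N : Set H}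

theorem isTraceClass (hA : IsRealTraceClass A) : IsTraceClass A := by
  let := realInnerProductSpace k (H := H)
  obtain ⟨S, hS⟩ := exists_isAbsOf A
  obtain ⟨N, hN⟩ := exists_isHilbertBasis k H
  obtain ⟨b, hb⟩ := exists_real_hilbertBasis hN
  have hSA' : realOp S * realOp S = star (realOp A) * realOp A := by
    rw [← realOp_star, ← realOp_mul, ← realOp_mul, hS.2.2]
  obtain ⟨-, W, hW⟩ := exists_polar_factors (isPositive_realOp hS.1 hS.2.1).isSelfAdjoint hSA'
  refine ⟨S, hS, N, hN, ?_⟩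
  have hsum : Summable fun p => ⟪b p, realOp S (b p)⟫_ℝ := by
    rw [hW]
    exact (IsHilbertSchmidtProduct.mul_left hA W).summable_inner b
  obtain ⟨j⟩ := instNonemptyFin (k := k)
  have hj := hsum.comp_injective (Prod.mk_left_injective (α := N) j)
  refine ((hj.hasSum.mapL (algebraMapCLM ℝ (Scalar k))).summable).congr fun u => ?_
  rw [sp_self_eq_algebraMap hS.1 u]
  change algebraMap ℝ (Scalar k) ⟪b (u, j), realOp S (b (u, j))⟫_ℝ = _
  rw [hb]
  exact congrArg _ (re_sp_onb_smul S j u)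

theorem mul_right (hA : IsRealTraceClass A) (B : BoundedOp k H) : IsRealTraceClass (A * B) :=
  let := realInnerProductSpace k (H := H)
  IsHilbertSchmidtProduct.mul_right hA (realOp B)

theorem mul_left (hA : IsRealTraceClass A) (B : BoundedOp k H) : IsRealTraceClass (B * A) :=
  let := realInnerProductSpace k (H := H)
  IsHilbertSchmidtProduct.mul_left hA (realOp B)

protected theorem star (hA : IsRealTraceClass A) : IsRealTraceClass (star A) := by
  let := realInnerProductSpace k (H := H)
  change IsHilbertSchmidtProduct (realOp (star A))
  rw [realOp_star]
  exact IsHilbertSchmidtProduct.star hA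

theorem add (hA : IsRealTraceClass A) (hB : IsRealTraceClass B) : IsRealTraceClass (A + B) :=
  let := realInnerProductSpace k (H := H)
  IsHilbertSchmidtProduct.add hA hB

theorem smul (hA : IsRealTraceClass A) (r : ℝ) : IsRealTraceClass (r • A) :=
  let := realInnerProductSpace k (H := H)
  IsHilbertSchmidtProduct.smul hA r

/-- The component of `⟨u|A u⟩` along the scalar `e` is a diagonal coefficient of the trace-class
real operator `x ↦ A (x e*)`, in a real Hilbert basis. -/
theorem summable_norm_sp (hA : IsRealTraceClass A) (hN : IsHilbertBasis k N) :
    Summable fun u : N => ‖sp k (u : H) (A u)‖ := by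
  let := realInnerProductSpace k (H := H)
  obtain ⟨b, hb⟩ := exists_real_hilbertBasis hN
  have hj : ∀ j, Summable fun u : N =>
      |Scalar.re (star (Scalar.onb j : Scalar k) * sp k (u : H) (A u))| := fun j => by
    have hs := (IsHilbertSchmidtProduct.mul_right hA
      (scalarOp (star (Scalar.onb j : Scalar k)))).summable_inner b
    refine ((hs.comp_injective (Prod.mk_left_injective (α := N) j)).abs).congr fun u => ?_
    change |⟪b (u, j), realOp A (scalarOp (star (Scalar.onb j : Scalar k)) (b (u, j)))⟫_ℝ| = _
    rw [hb]
    change |Scalar.re (sp k (MulOpposite.op (Scalar.onb j : Scalar k) • (u : H))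
      (A (MulOpposite.op (star (Scalar.onb j : Scalar k)) •
        MulOpposite.op (Scalar.onb j : Scalar k) • (u : H))))| = _
    rw [smul_smul, ← MulOpposite.op_mul, onb_mul_star, MulOpposite.op_one, one_smul, sp_smul_left]
  exact Summable.of_nonneg_of_le (fun _ => norm_nonneg _) (fun u => norm_le_sum_abs_re _)
    (summable_sum fun j _ => hj j)

theorem summable_sp (hA : IsRealTraceClass A) (hN : IsHilbertBasis k N) :
    Summable fun u : N => sp k (u : H) (A u) :=
  (hA.summable_norm_sp hN).of_norm

/-- The trace of the real operator underlying `A` is `dim_ℝ 𝔻` times the real part of `tr_N A`. -/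
theorem exists_tsum_inner (hN : IsHilbertBasis k N) :
    letI := realInnerProductSpace k (H := H)
    ∃ b : HilbertBasis (N × Fin (Module.finrank ℝ (Scalar k))) ℝ H, ∀ B : BoundedOp k H,
      IsRealTraceClass B → ∑' p, ⟪b p, realOp B (b p)⟫_ℝ =
        Module.finrank ℝ (Scalar k) * Scalar.re (basisTrace N B) := by
  let := realInnerProductSpace k (H := H)
  obtain ⟨b, hb⟩ := exists_real_hilbertBasis hN
  refine ⟨b, fun B hB => ?_⟩
  have hterm : ∀ p, ⟪b p, realOp B (b p)⟫_ℝ = Scalar.re (sp k (p.1 : H) (B p.1)) := fun p => by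
    rw [hb p]
    exact re_sp_onb_smul B p.2 p.1
  rw [(IsHilbertSchmidtProduct.summable_inner b hB).tsum_prod, basisTrace,
    ← Scalar.reCLM_apply, Scalar.reCLM.map_tsum (hB.summable_sp hN), ← tsum_mul_left]
  simp_rw [hterm]
  refine tsum_congr fun u => ?_
  rw [tsum_const, Nat.card_fin, nsmul_eq_mul]
  rfl

theorem finrank_ne_zero : (Module.finrank ℝ (Scalar k) : ℝ) ≠ 0 :=
  Nat.cast_ne_zero.2 Module.finrank_pos.ne'

theorem re_basisTrace_eq {N' : Set H} (hA : IsRealTraceClass A) (hN : IsHilbertBasis k N)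
    (hN' : IsHilbertBasis k N') :
    Scalar.re (basisTrace N A) = Scalar.re (basisTrace N' A) := by
  let := realInnerProductSpace k (H := H)
  obtain ⟨b, hb⟩ := exists_tsum_inner hN
  obtain ⟨b', hb'⟩ := exists_tsum_inner hN'
  refine mul_left_cancel₀ finrank_ne_zero ((hb A hA).symm.trans (Eq.trans ?_ (hb' A hA)))
  exact IsHilbertSchmidtProduct.tsum_inner_eq b b' hA

theorem re_basisTrace (hA : IsRealTraceClass A) (hN : IsHilbertBasis k N) :
    Scalar.re (basisTrace N A) = realTrace A :=
  hA.re_basisTrace_eq hN (exists_isHilbertBasis k H).choose_spec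

/-! ### Properties of the real trace -/

theorem hasSum_re (hA : IsRealTraceClass A) (hN : IsHilbertBasis k N) :
    HasSum (fun u : N => Scalar.re (sp k (u : H) (A u))) (realTrace A) := by
  rw [← hA.re_basisTrace hN]
  exact (hA.summable_sp hN).hasSum.mapL Scalar.reCLM

theorem realTrace_mul_comm (hA : IsRealTraceClass A) (B : BoundedOp k H) :
    realTrace (A * B) = realTrace (B * A) := by
  let := realInnerProductSpace k (H := H)
  obtain ⟨N, hN⟩ := exists_isHilbertBasis k H
  obtain ⟨b, hb⟩ := exists_tsum_inner hN
  have hAB := hA.mul_right B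
  have hBA := hA.mul_left B
  rw [← hAB.re_basisTrace hN, ← hBA.re_basisTrace hN]
  refine mul_left_cancel₀ finrank_ne_zero ((hb _ hAB).symm.trans (Eq.trans ?_ (hb _ hBA)))
  exact IsHilbertSchmidtProduct.tsum_inner_mul_comm b hA (realOp B)

theorem realTrace_add (hA : IsRealTraceClass A) (hB : IsRealTraceClass B) :
    realTrace (A + B) = realTrace A + realTrace B := by
  obtain ⟨N, hN⟩ := exists_isHilbertBasis k H
  refine ((hA.add hB).hasSum_re hN).unique (((hA.hasSum_re hN).add (hB.hasSum_re hN)).congr_fun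
    fun u => ?_)
  rw [← Scalar.re_add, ← sp_add_right]
  rfl

theorem realTrace_smul (hA : IsRealTraceClass A) (r : ℝ) :
    realTrace (r • A) = r * realTrace A := by
  obtain ⟨N, hN⟩ := exists_isHilbertBasis k H
  refine ((hA.smul r).hasSum_re hN).unique (((hA.hasSum_re hN).mul_left r).congr_fun fun u => ?_)
  rw [← Scalar.re_smul, ← sp_real_smul_right]
  rfl

theorem realTrace_star (hA : IsRealTraceClass A) : realTrace (star A) = realTrace A := by
  obtain ⟨N, hN⟩ := exists_isHilbertBasis k H
  refine (hA.star.hasSum_re hN).unique ((hA.hasSum_re hN).congr_fun fun u => ?_)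
  rw [sp_star_right, ← star_sp, Scalar.re_star]

theorem realTrace_nonneg (hA : IsRealTraceClass A) (hpos : IsPositiveOp A) :
    0 ≤ realTrace A := by
  obtain ⟨N, hN⟩ := exists_isHilbertBasis k H
  refine (hA.hasSum_re hN).nonneg fun u => ?_
  obtain ⟨r, hr, h⟩ := hpos u
  rwa [h, Scalar.re_algebraMap]

theorem realTrace_mono (hA : IsRealTraceClass A) (hB : IsRealTraceClass B)
    (h : IsPositiveOp (A - B)) : realTrace B ≤ realTrace A := by
  have hAB : IsRealTraceClass (A - B) := by
    rw [sub_eq_add_neg, ← neg_one_smul ℝ B]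
    exact hA.add (hB.smul _)
  have := hAB.realTrace_add hB
  rw [sub_add_cancel] at this
  have := hAB.realTrace_nonneg h
  linarith

theorem hasSum_of_star_eq (hA : IsRealTraceClass A) (hN : IsHilbertBasis k N)
    (h : ∀ u : N, star (sp k (u : H) (A u)) = sp k (u : H) (A u)) :
    HasSum (fun u : N => sp k (u : H) (A u)) (algebraMap ℝ (Scalar k) (realTrace A)) := by
  rw [← hA.re_basisTrace hN]
  exact hasSum_algebraMap (hA.summable_sp hN) h

theorem hasTrace (hA : IsRealTraceClass A) (hsa : IsSelfAdjoint A) :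
    HasTrace A (algebraMap ℝ (Scalar k) (realTrace A)) :=
  fun _ hN => hA.hasSum_of_star_eq hN fun u => star_sp_self hsa u

/-! ### Products of self-adjoint operators -/

/-- For `u ∈ N` an eigenvector of `A`, with a real eigenvalue `q`, `⟨u|A B u⟩ = q ⟨u|B u⟩`; the
other vectors of `N` lie in the kernel of `A`. -/
theorem hasSum_mul_of_isEigenCompletion (hA : IsRealTraceClass A) (hsaA : IsSelfAdjoint A)
    (hsaB : IsSelfAdjoint B) (hN : IsEigenCompletion A N) :
    HasSum (fun u : N => sp k (u : H) ((A * B) u))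
      (algebraMap ℝ (Scalar k) (realTrace (A * B))) := by
  obtain ⟨hN, M, hMN, hM, hM'⟩ := hN
  refine (hA.mul_right B).hasSum_of_star_eq hN ?_
  rintro ⟨u, hu⟩
  have hsymm : ∀ x y, sp k x (A y) = sp k (A x) y := fun x y => by
    rw [← sp_star_right, hsaA.star_eq]
  change star (sp k u (A (B u))) = sp k u (A (B u))
  rw [hsymm]
  by_cases huM : u ∈ M
  · obtain ⟨-, q, hq⟩ := hM u huM
    have hqu : sp k u (A u) = q := by
      rw [hq, sp_smul_right, hN.1.1 u hu, one_mul]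
    have hq' : q = algebraMap ℝ (Scalar k) (Scalar.re q) := by
      rw [← hqu]
      exact sp_self_eq_algebraMap hsaA u
    rw [hq, sp_smul_left, sp_self_eq_algebraMap hsaB u, hq', Scalar.star_algebraMap, ← map_mul,
      Scalar.star_algebraMap]
  · have hAu : A u = 0 := by
      refine hM' _ (fun z hz => ?_) fun m hm => ?_
      · rw [hsymm, hz, ← zero_smul (Scalar k)ᵐᵒᵖ (0 : H), ← MulOpposite.op_zero, sp_smul_left,
          star_zero, zero_mul]
      · obtain ⟨-, q, hq⟩ := hM m hm
        rw [hsymm, hq, sp_smul_left, hN.1.2 m (hMN hm) u hu fun h => huM (h ▸ hm), mul_zero]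
    rw [hAu, ← zero_smul (Scalar k)ᵐᵒᵖ (0 : H), ← MulOpposite.op_zero, sp_smul_left,
      star_zero, zero_mul, star_zero]

end IsRealTraceClass

omit [CompleteSpace H] in
/-- Over commutative scalars, multiplication by a scalar is a `𝔻`-linear operator. -/
theorem exists_scalar_op (hk : k ≠ .quaternionic) (q : Scalar k) :
    ∃ C : BoundedOp k H, ∀ x, C x = MulOpposite.op q • x := by
  obtain ⟨C, hC⟩ := exists_realOp_eq (C := (scalarOp q : H →L[ℝ] H)) (k := k) fun p => by
    ext x
    change MulOpposite.op p • MulOpposite.op q • x = MulOpposite.op q • MulOpposite.op p • x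
    rw [smul_smul, smul_smul, ← MulOpposite.op_mul, ← MulOpposite.op_mul,
      Scalar.mul_comm_of_ne hk]
  exact ⟨C, fun x => congrArg (fun Z : H →L[ℝ] H => Z x) hC⟩

/-- If `w = tr_N (A B) - tr_N (A B)*`, then `‖w‖² = -2 Re (tr_N (A B) w) = -2 tr^ℝ (A B w)`, which
vanishes because `(A B w)* = -w B A` has the same real trace as `-A B w`. -/
theorem IsRealTraceClass.hasTrace_mul {A B : BoundedOp k H} (hk : k ≠ .quaternionic)
    (hA : IsRealTraceClass A) (hsaA : IsSelfAdjoint A) (hsaB : IsSelfAdjoint B) :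
    HasTrace (A * B) (algebraMap ℝ (Scalar k) (realTrace (A * B))) := by
  intro N hN
  have hAB := hA.mul_right B
  set s := basisTrace N (A * B) with hs
  have hsum : HasSum (fun u : N => sp k (u : H) ((A * B) u)) s := (hAB.summable_sp hN).hasSum
  -- a skew scalar `w` gives `tr^ℝ (A B w) = 0`
  have hskew : ∀ w : Scalar k, star w = -w → Scalar.re (s * w) = 0 := fun w hw => by
    obtain ⟨C, hC⟩ := exists_scalar_op (H := H) hk w
    have hcomm : ∀ T : BoundedOp k H, T * C = C * T := fun T => by
      ext x
      change T (C x) = C (T x)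
      rw [hC, hC, map_smul]
    have hstarC : star C = (-1 : ℝ) • C := star_eq_of_sp fun x y => by
      change sp k ((-1 : ℝ) • C x) y = sp k x (C y)
      rw [hC, hC, sp_smul_right, real_smul_eq k, smul_smul, ← MulOpposite.op_mul, sp_smul_left,
        map_neg, map_one, mul_neg_one, star_neg, hw, neg_neg, Scalar.mul_comm_of_ne hk]
    have h1 : realTrace (A * B * C) = Scalar.re (s * w) := by
      rw [← (hAB.mul_right C).re_basisTrace hN, basisTrace, ← (hsum.mul_right w).tsum_eq]
      congr 1
      refine tsum_congr fun u => ?_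
      change sp k (u : H) ((A * B) (C u)) = _
      rw [hC, map_smul, sp_smul_right]
    have h2 : realTrace (A * B * C) = -realTrace (A * B * C) := by
      have h3 : C * (B * A) = B * (C * A) := by rw [← mul_assoc, ← hcomm B, mul_assoc]
      have h4 : C * A * B = A * B * C := by rw [← hcomm A, mul_assoc, ← hcomm B, ← mul_assoc]
      calc realTrace (A * B * C) = realTrace (star (A * B * C)) :=
            (hAB.mul_right C).realTrace_star.symm
        _ = -realTrace (C * (B * A)) := by
          rw [star_mul_op, star_mul_op, hsaA.star_eq, hsaB.star_eq, hstarC, smul_mul_assoc,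
            ((hA.mul_left B).mul_left C).realTrace_smul, neg_one_mul]
        _ = -realTrace (A * B * C) := by
          rw [h3, ← (hA.mul_left C).realTrace_mul_comm, h4]
    linarith
  have hreal : star s = s := by
    have hw : star (s - star s) = -(s - star s) := by
      rw [star_sub, star_star, neg_sub]
    have h1 := hskew _ hw
    have h2 : Scalar.re (star s * (s - star s)) = -Scalar.re (s * (s - star s)) := by
      rw [← Scalar.re_star, star_mul, star_star, hw, neg_mul, Scalar.re_mul_comm s,
        ← Scalar.reCLM_apply, map_neg, Scalar.reCLM_apply]
    have h3 : Scalar.re ((s - star s) * star (s - star s)) = 0 := by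
      rw [hw, mul_neg, sub_mul, ← Scalar.reCLM_apply, map_neg, map_sub, Scalar.reCLM_apply,
        Scalar.reCLM_apply, h2, h1]
      norm_num
    exact (sub_eq_zero.1 (Scalar.eq_zero_of_re_mul_star h3)).symm
  rw [← hAB.re_basisTrace hN, ← hs, ← Scalar.eq_algebraMap_re hreal]
  exact hsum

end Trace

end RealTrace

open RealTrace
theorem corollary2p1 (k : ScalarKind) {H : Type*} [NormedAddCommGroup H] [NormedSpace ℝ H]
    [CompleteSpace H] [HilbertSpaceOver k H] :
    -- the real trace of a trace-class operator is well defined, whatever the Hilbert basis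
    (∀ A : BoundedOp k H, IsTraceClass A → ∀ N : Set H, IsHilbertBasis k N →
      (Summable fun u : N => ‖sp k (u : H) (A u)‖) ∧
        Scalar.re (basisTrace N A) = realTrace A) ∧
    -- it is real linear on the real vector space of trace-class operators
    (∃ (B₁ : Submodule ℝ (BoundedOp k H)) (τ : B₁ →ₗ[ℝ] ℝ),
      (∀ A : BoundedOp k H, A ∈ B₁ ↔ IsTraceClass A) ∧
        ∀ A : B₁, τ A = realTrace (A : BoundedOp k H)) ∧
    -- it is invariant under taking adjoints
    (∀ A : BoundedOp k H, IsTraceClass A →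
      IsTraceClass (star A) ∧ realTrace (star A) = realTrace A) ∧
    -- positivity
    (∀ A : BoundedOp k H, IsTraceClass A → IsPositiveOp A → 0 ≤ realTrace A) ∧
    -- monotonicity
    (∀ A B : BoundedOp k H, IsTraceClass A → IsTraceClass B → IsPositiveOp (A - B) →
      realTrace B ≤ realTrace A) ∧
    -- cyclicity
    (∀ A B : BoundedOp k H, IsTraceClass A →
      IsTraceClass (A * B) ∧ IsTraceClass (B * A) ∧ realTrace (A * B) = realTrace (B * A)) ∧
    -- agreement with the trace on self-adjoint operators
    (∀ A : BoundedOp k H, IsTraceClass A → IsSelfAdjoint A →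
      HasTrace A (algebraMap ℝ (Scalar k) (realTrace A))) ∧
    -- products of self-adjoint operators, real and complex scalars
    (k ≠ ScalarKind.quaternionic →
      ∀ A B : BoundedOp k H, IsTraceClass A → IsSelfAdjoint A → IsSelfAdjoint B →
        HasTrace (A * B) (algebraMap ℝ (Scalar k) (realTrace (A * B)))) ∧
    -- products of self-adjoint operators, quaternionic scalars
    (k = ScalarKind.quaternionic →
      ∀ A B : BoundedOp k H, IsTraceClass A → IsSelfAdjoint A → IsSelfAdjoint B →
        ∀ N : Set H, IsEigenCompletion A N →
          HasSum (fun u : N => sp k (u : H) ((A * B) u))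
            (algebraMap ℝ (Scalar k) (realTrace (A * B)))) ∧
    -- orthogonal projectors
    (∀ A P : BoundedOp k H, IsTraceClass A → IsSelfAdjoint A → IsStarProjection P →
      IsTraceClass (P * A) ∧ IsTraceClass (P * A * P) ∧
        realTrace (P * A) = realTrace (P * A * P) ∧
        HasTrace (P * A * P) (algebraMap ℝ (Scalar k) (realTrace (P * A * P)))) := by
  have hmem : ∀ {A : BoundedOp k H}, IsRealTraceClass A ↔ IsTraceClass A :=
    ⟨fun h => h.isTraceClass, fun h => h.isRealTraceClass⟩
  simp only [← hmem]
  refine ⟨fun A hA N hN => ⟨hA.summable_norm_sp hN, hA.re_basisTrace hN⟩, ?_,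
    fun A hA => ⟨hA.star, hA.realTrace_star⟩, fun A hA => hA.realTrace_nonneg,
    fun A B hA hB => hA.realTrace_mono hB,
    fun A B hA => ⟨hA.mul_right B, hA.mul_left B, hA.realTrace_mul_comm B⟩,
    fun A hA => hA.hasTrace, fun hk A B hA => hA.hasTrace_mul hk,
    fun _ A B hA hsaA hsaB N => hA.hasSum_mul_of_isEigenCompletion hsaA hsaB,
    fun A P hA hsa hP => ?_⟩
  · let B₁ : Submodule ℝ (BoundedOp k H) :=
      { carrier := {A | IsRealTraceClass A}
        add_mem' := fun hA hB => hA.add hB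
        zero_mem' := isRealTraceClass_zero
        smul_mem' := fun r _ hA => hA.smul r }
    exact ⟨B₁,
      { toFun := fun A => realTrace (A : BoundedOp k H)
        map_add' := fun A B => A.2.realTrace_add B.2
        map_smul' := fun r A => A.2.realTrace_smul r },
      fun _ => Iff.rfl, fun _ => rfl⟩
  · have hPA := hA.mul_left P
    have hPAP := hPA.mul_right P
    refine ⟨hPA, hPAP, ?_, hPAP.hasTrace ?_⟩
    · rw [hPA.realTrace_mul_comm P, ← mul_assoc, hP.isIdempotentElem.eq]
    · rw [isSelfAdjoint_iff, star_mul_op, star_mul_op, hsa.star_eq, hP.isSelfAdjoint.star_eq,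
        mul_assoc]
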